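/- Let $\mathcal X,\mathcal Y$ be finite-dimensional real Hilbert spaces, let $\Theta$ be an open subset of a finite-dimensional Euclidean space $T$, and fix $y\in\mathcal Y$, an integer $Q\ge 1$ and $\nu>0$. Let $F:\mathcal X\times\mathcal Y\times\Theta\to\mathbb R$ and $G_1,\dots,G_Q:\mathcal X\times\mathcal Y\times\Theta\to(-\infty,+\infty]$ be such that, for every $\theta\in\Theta$, $F(\cdot,y,\theta)$ is $C^1$ with gradient $\nabla_1F(\cdot,y,\theta)$ and each $G_k(\cdot,y,\theta)$ is proper, closed and convex. For such $G$ put $$\mathrm{Prox}_{\nu QG_k}(x,y,\theta)=\operatorname*{argmin}_{z\in\mathcal X}\ \tfrac12\|z-x\|^2+\nu Q\,G_k(z,y,\theta).$$ Assume that $(x,\theta)\mapsto\nabla_1F(x,y,\theta)$ is locally Lipschitz on $\mathcal X\times\Theta$ and that each $\theta\mapsto\mathrm{Prox}_{\nu QG_k}(x,y,\theta)$ is locally Lipschitz on $\Theta$, locally uniformly in $x$. The Generalized Forward–Backward (GFB) iterates $a^{(\ell)}=(\xi^{(\ell)},z_1^{(\ell)},\dots,z_Q^{(\ell)})\in\mathcal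 A=\mathcal X^{1+Q}$, $x^{(\ell)}=\gamma(a^{(\ell)}):=\xi^{(\ell)}$, start at a point $a^{(0)}(y,\theta)$ that is locally Lipschitz in $\theta\in\Theta$, and satisfy $a^{(\ell+1)}=\psi(a^{(\ell)},y,\theta)$, where $\psi$ is defined by $$x^{(\ell+1)}=\frac1Q\sum_{k=1}^Qz_k^{(\ell+1)},\qquad z_k^{(\ell+1)}=z_k^{(\ell)}-x^{(\ell)}+\mathrm{Prox}_{\nu QG_k}(Z_k^{(\ell)},y,\theta),\qquad Z_k^{(\ell)}=2x^{(\ell)}-z_k^{(\ell)}-\nu\nabla_1F(x^{(\ell)},y,\theta).$$ A weak Jacobian on $\Theta$ of a locally integrable map $f$ with values in a finite-dimensional space $E$ is a locally integrable map $J$ on $\Theta$ with values in the linear maps $T\to E$ such that $\int_\Theta\varphi\,J[v]\,d\theta=-\int_\Theta (D\varphi[v])\,f\,d\theta$ for all $v\in T$ and $\varphi\in C^1_c(\Theta)$. Partial Jacobians $\partial_1,\partial_3$ below are Fréchet derivatives in the first and third argument, and $D_{(v,\delta)}h$ is the two-sided directional derivative of $(x,\theta)\mapsto h(x,y,\theta)$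 (resp. $(a,\theta)\mapsto h(a,y,\theta)$) in the direction $(v,\delta)$. Then for all $\ell\ge0$ and $1\le k\le Q$ the maps $\theta\mapsto a^{(\ell)},x^{(\ell)},z_k^{(\ell)},Z_k^{(\ell)}$ have weak Jacobians on $\Theta$. For any choice $\mathcal J_a^{(\ell)},\mathcal J_x^{(\ell)},\mathcal J_{z_k}^{(\ell)},\mathcal J_{Z_k}^{(\ell)}$ of them and every $\ell\ge 0$, the following holds for Lebesgue-almost every $\theta\in\Theta$ (all derivatives of $\psi$, $\mathrm{Prox}_{\nu QG_k}$ and $\nabla_1F$ being taken at $(a^{(\ell)},y,\theta)$, $(Z_k^{(\ell)},y,\theta)$ and $(x^{(\ell)},y,\theta)$ respectively). 1. $\mathcal J_a^{(\ell)}=(\mathcal J_x^{(\ell)},\mathcal J_{z_1}^{(\ell)},\dots,\mathcal J_{z_Q}^{(\ell)})$, $\ \mathcal J_x^{(\ell)}=\Gamma_a^{(\ell)}\mathcal J_a^{(\ell)}$ with $\Gamma_a^{(\ell)}=D\gamma(a^{(\ell)})$, and $\mathcal J_x^{(\ell+1)}=\frac1Q\sum_{k}\mathcal J_{z_k}^{(\ell+1)}$.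 2. If $\psi(\cdot,y,\cdot)$ is differentiable at $(a^{(\ell)},\theta)$, then $\mathcal J_a^{(\ell+1)}=\Psi_a^{(\ell)}\mathcal J_a^{(\ell)}+\Psi_\theta^{(\ell)}$ with $\Psi_a^{(\ell)}=\partial_1\psi$, $\Psi_\theta^{(\ell)}=\partial_3\psi$. 3. For each $k$, if $\mathrm{Prox}_{\nu QG_k}(\cdot,y,\cdot)$ is differentiable at $(Z_k^{(\ell)},\theta)$, then $$\mathcal J_{z_k}^{(\ell+1)}=\mathcal J_{z_k}^{(\ell)}-\mathcal J_x^{(\ell)}+\mathcal G_{k,x}^{(\ell)}\mathcal J_{Z_k}^{(\ell)}+\mathcal G_{k,\theta}^{(\ell)},\qquad \mathcal G_{k,x}^{(\ell)}=\partial_1\mathrm{Prox}_{\nu QG_k},\quad \mathcal G_{k,\theta}^{(\ell)}=\partial_3\mathrm{Prox}_{\nu QG_k}.$$ 4. If $\nabla_1F(\cdot,y,\cdot)$ is differentiable at $(x^{(\ell)},\theta)$, then for each $k$ $$\mathcal J_{Z_k}^{(\ell)}=2\mathcal J_x^{(\ell)}-\mathcal J_{z_k}^{(\ell)}-\nu\big(\mathcal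 F_x^{(\ell)}\mathcal J_x^{(\ell)}+\mathcal F_\theta^{(\ell)}\big),\qquad \mathcal F_x^{(\ell)}=\partial_1\nabla_1F,\quad \mathcal F_\theta^{(\ell)}=\partial_3\nabla_1F.$$ 5. Without any differentiability of these maps at the iterates, for every $k$ and every $\delta\in T$ the following directional derivatives exist and $$\mathcal J_a^{(\ell+1)}\delta=D_{(\mathcal J_a^{(\ell)}\delta,\,\delta)}\psi,\qquad \mathcal J_{z_k}^{(\ell+1)}\delta=\mathcal J_{z_k}^{(\ell)}\delta-\mathcal J_x^{(\ell)}\delta+D_{(\mathcal J_{Z_k}^{(\ell)}\delta,\,\delta)}\mathrm{Prox}_{\nu QG_k},$$ $$\mathcal J_{Z_k}^{(\ell)}\delta=2\mathcal J_x^{(\ell)}\delta-\mathcal J_{z_k}^{(\ell)}\delta-\nu\,D_{(\mathcal J_x^{(\ell)}\delta,\,\delta)}\nabla_1F .$$ -/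

import Mathlib

open MeasureTheory Filter Topology
open scoped NNReal

namespace GFB

section Weak

variable {T : Type*} [NormedAddCommGroup T] [InnerProductSpace ℝ T] [FiniteDimensional ℝ T]
  [MeasurableSpace T] [BorelSpace T]
variable {E : Type*} [NormedAddCommGroup E] [NormedSpace ℝ E]

/-- `J` is a weak Jacobian of `f` on the open set `Ω`: both are locally integrable on `Ω` and the
integration by parts formula holds in every direction `v` (linearly in `v`, hence for all partial
derivatives) against all `C¹` test functions with compact support in `Ω`. -/
def IsWeakJacobian (Ω : Set T) (f : T → E) (J : T → T →L[ℝ] E) : Prop :=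
  LocallyIntegrableOn f Ω volume ∧ LocallyIntegrableOn J Ω volume ∧
    ∀ φ : T → ℝ, ContDiff ℝ 1 φ → HasCompactSupport φ → tsupport φ ⊆ Ω →
      ∀ v : T, ∫ θ in Ω, φ θ • J θ v = - ∫ θ in Ω, fderiv ℝ φ θ v • f θ

end Weak

section Jacobians

variable {A T B : Type*} [NormedAddCommGroup A] [NormedSpace ℝ A]
  [NormedAddCommGroup T] [NormedSpace ℝ T] [NormedAddCommGroup B] [NormedSpace ℝ B]

/-- Partial Jacobian of `f (a, y, θ)` in its first argument. -/
noncomputable def jac1 {Y : Type*} (f : A → Y → T → B) (a : A) (y : Y) (θ : T) : A →L[ℝ] B :=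
  fderiv ℝ (fun a' => f a' y θ) a

/-- Partial Jacobian of `f (a, y, θ)` in its third argument. -/
noncomputable def jac3 {Y : Type*} (f : A → Y → T → B) (a : A) (y : Y) (θ : T) : T →L[ℝ] B :=
  fderiv ℝ (fun θ' => f a y θ') θ

/-- `f (·, y, ·)` as a function of the pair `(a, θ)`, with `y` frozen. -/
def atObs {Y : Type*} (f : A → Y → T → B) (y : Y) : A × T → B := fun p => f p.1 y p.2

/-- `θ ↦ f (a, θ)` is locally Lipschitz on `Ω`, locally uniformly in `a`. -/
def LocallyLipschitzInParam (Ω : Set T) (f : A → T → B) : Prop :=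
  ∀ a₀ : A, ∀ θ₀ ∈ Ω, ∃ K : ℝ≥0, ∃ U ∈ 𝓝 a₀, ∃ V ∈ 𝓝 θ₀,
    ∀ a ∈ U, LipschitzOnWith K (f a) (V ∩ Ω)

end Jacobians

section Convex

variable {X : Type*} [NormedAddCommGroup X] [InnerProductSpace ℝ X]

/-- Proper, closed (lower semicontinuous) and convex extended-real-valued functions. -/
structure IsProperClosedConvex (g : X → EReal) : Prop where
  ne_bot : ∀ x, g x ≠ ⊥
  exists_ne_top : ∃ x, g x ≠ ⊤
  closed : LowerSemicontinuous g
  convex : Convex ℝ {p : X × ℝ | g p.1 ≤ (p.2 : EReal)}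

/-- `p` minimizes `z ↦ ½‖z - x‖² + g z`. -/
def IsProxPoint (g : X → EReal) (x p : X) : Prop :=
  ∀ z : X, (((1 / 2) * ‖p - x‖ ^ 2 : ℝ) : EReal) + g p ≤
    (((1 / 2) * ‖z - x‖ ^ 2 : ℝ) : EReal) + g z

open Classical in
/-- The proximal mapping of `g`: the minimizer of `z ↦ ½‖z - x‖² + g z`, which exists and is unique
for `g` proper, closed and convex on a Hilbert space (default value `x` if there is none). -/
noncomputable def prox (g : X → EReal) (x : X) : X :=
  if h : ∃ p, IsProxPoint g x p then h.choose else x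

/-- `Prox_{ν Q G_k} (x, y, θ)`. -/
noncomputable def proxG {Y T : Type*} {Q : ℕ} (ν : ℝ) (G : Fin Q → X → Y → T → EReal) (k : Fin Q)
    (x : X) (y : Y) (θ : T) : X :=
  prox (fun z => ((ν * (Q : ℝ) : ℝ) : EReal) * G k z y θ) x

end Convex

section Algorithm

variable {X Y T : Type*} [NormedAddCommGroup X] [InnerProductSpace ℝ X] [CompleteSpace X]
variable {Q : ℕ}

/-- `∇₁F (x, y, θ)`. -/
noncomputable def grad1 (F : X → Y → T → ℝ) (x : X) (y : Y) (θ : T) : X :=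
  gradient (fun x' => F x' y θ) x

/-- `Z_k = 2 x - z_k - ν ∇₁F (x, y, θ)`, as a function of `a = (x, z_1, …, z_Q)`. -/
noncomputable def zarg (F : X → Y → T → ℝ) (ν : ℝ) (k : Fin Q)
    (a : X × (Fin Q → X)) (y : Y) (θ : T) : X :=
  (2 : ℝ) • a.1 - a.2 k - ν • grad1 F a.1 y θ

/-- The update of `z_k`, as a function of `a = (x, z_1, …, z_Q)`. -/
noncomputable def znext (F : X → Y → T → ℝ) (G : Fin Q → X → Y → T → EReal) (ν : ℝ) (k : Fin Q)
    (a : X × (Fin Q → X)) (y : Y) (θ : T) : X :=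
  a.2 k - a.1 + proxG ν G k (zarg F ν k a y θ) y θ

/-- The iteration map `ψ` on `X^{1+Q}`. -/
noncomputable def psi (F : X → Y → T → ℝ) (G : Fin Q → X → Y → T → EReal) (ν : ℝ)
    (a : X × (Fin Q → X)) (y : Y) (θ : T) : X × (Fin Q → X) :=
  ((1 / (Q : ℝ)) • ∑ k, znext F G ν k a y θ, fun k => znext F G ν k a y θ)

/-- The output map `γ (ξ, z_1, …, z_Q) = ξ`. -/
def gam (a : X × (Fin Q → X)) : X := a.1

/-- The iterates `a^{(ℓ)} (y, θ)`, started at `a^{(0)} (y, θ) = a₀ y θ`. -/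
noncomputable def iter (F : X → Y → T → ℝ) (G : Fin Q → X → Y → T → EReal) (ν : ℝ)
    (a₀ : Y → T → X × (Fin Q → X)) : ℕ → Y → T → X × (Fin Q → X)
  | 0, y, θ => a₀ y θ
  | ℓ + 1, y, θ => psi F G ν (iter F G ν a₀ ℓ y θ) y θ

end Algorithm

end GFB

/-!
The proximal map of a proper closed convex function is nonexpansive, by the variational inequality
of its minimization problem. Together with the Lipschitz dependence on the parameter, this makes
`ψ` jointly locally Lipschitz, so all iterates are locally Lipschitz in `θ`. By Rademacher's theorem
and the a.e. uniqueness of weak Jacobians, every weak Jacobian of such a map is a.e. its Fréchet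
derivative, and the recursions become pointwise chain rules. Where the outer map is not
differentiable, Lipschitz continuity still lets its derivative along a line be computed along any
curve tangent to that line, and the curves traced by the iterates are such curves.
-/

namespace GFB

section Prox

lemma coe_mul_le_coe_iff {c : ℝ} (hc : 0 < c) {u : EReal} {r : ℝ} :
    (c : EReal) * u ≤ r ↔ u ≤ ((r / c : ℝ) : EReal) := by
  rw [EReal.coe_div, EReal.le_div_iff_mul_le (EReal.coe_pos.2 hc) (EReal.coe_ne_top c), mul_comm]

lemma continuous_coe_mul {c : ℝ} (hc : c ≠ 0) : Continuous fun u : EReal => (c : EReal) * u := by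
  refine continuous_iff_continuousAt.2 fun u => ?_
  have hmul : ContinuousAt (fun p : EReal × EReal => p.1 * p.2) ((c : EReal), u) := by
    apply EReal.continuousAt_mul <;> simp [hc]
  exact hmul.comp (f := fun u : EReal => ((c : EReal), u)) (by fun_prop)

lemma exists_forall_le_of_lowerSemicontinuous {α β : Type*} [TopologicalSpace α] [LinearOrder β]
    {f : α → β} (hf : LowerSemicontinuous f) (x₀ : α) (h : ∀ᶠ x in cocompact α, f x₀ ≤ f x) :
    ∃ x, ∀ x', f x ≤ f x' := by
  obtain ⟨K, hK, hKf⟩ := mem_cocompact.1 h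
  obtain ⟨x, -, hx⟩ := LowerSemicontinuousOn.exists_isMinOn (Set.insert_nonempty x₀ K)
    (hK.insert x₀) (hf.lowerSemicontinuousOn _)
  refine ⟨x, fun x' => ?_⟩
  by_cases hx' : x' ∈ K
  · exact hx (Set.mem_insert_of_mem x₀ hx')
  · exact (hx (Set.mem_insert x₀ K)).trans (hKf hx')

lemma apply_add_smul_sub_le_of_convex_epigraph {X : Type*} [AddCommGroup X] [Module ℝ X]
    {g : X → EReal} (hg : Convex ℝ {p : X × ℝ | g p.1 ≤ (p.2 : EReal)}) {p q : X} {r s t : ℝ}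
    (hp : g p ≤ r) (hq : g q ≤ s) (ht0 : 0 ≤ t) (ht1 : t ≤ 1) :
    g (p + t • (q - p)) ≤ ((r + t * (s - r) : ℝ) : EReal) :=
  hg.add_smul_sub_mem (x := (p, r)) (y := (q, s)) hp hq ⟨ht0, ht1⟩

variable {X : Type*} [NormedAddCommGroup X] [InnerProductSpace ℝ X] {g : X → EReal}

lemma IsProperClosedConvex.const_mul (hg : IsProperClosedConvex g) {c : ℝ} (hc : 0 < c) :
    IsProperClosedConvex (fun x => (c : EReal) * g x) where
  ne_bot x := by simp [EReal.mul_ne_bot, hg.ne_bot x, hc.le]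
  exists_ne_top := by
    obtain ⟨x, hx⟩ := hg.exists_ne_top
    exact ⟨x, by simp [EReal.mul_ne_top, hx, hc.le]⟩
  closed := (continuous_coe_mul hc.ne').comp_lowerSemicontinuous hg.closed
    fun _ _ huv => mul_le_mul_of_nonneg_left huv (EReal.coe_nonneg.2 hc.le)
  convex := by
    simp only [coe_mul_le_coe_iff hc, div_eq_inv_mul]
    exact hg.convex.linear_preimage (LinearMap.id.prodMap (c⁻¹ • LinearMap.id))

lemma IsProperClosedConvex.exists_coe_le_of_isCompact (hg : IsProperClosedConvex g) {K : Set X}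
    (hK : IsCompact K) : ∃ m : ℝ, ∀ z ∈ K, (m : EReal) ≤ g z := by
  rcases K.eq_empty_or_nonempty with rfl | hne
  · exact ⟨0, by simp⟩
  · obtain ⟨w, -, hw⟩ := LowerSemicontinuousOn.exists_isMinOn hne hK
      (hg.closed.lowerSemicontinuousOn K)
    exact ⟨(g w).toReal, fun z hz => (EReal.coe_toReal_le (hg.ne_bot w)).trans (hw hz)⟩

lemma IsProperClosedConvex.coe_sub_mul_norm_le (hg : IsProperClosedConvex g) {x₀ : X} {m r : ℝ}
    (hr : g x₀ ≤ r) (hm : ∀ z ∈ Metric.closedBall x₀ 1, (m : EReal) ≤ g z) (z : X) :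
    ((m - (r - m) * ‖z - x₀‖ : ℝ) : EReal) ≤ g z := by
  have hmr : m ≤ r := EReal.coe_le_coe_iff.1 ((hm x₀ (by simp)).trans hr)
  rcases le_total ‖z - x₀‖ 1 with hz | hz
  · refine le_trans (EReal.coe_le_coe_iff.2 ?_) (hm z (by simpa [dist_eq_norm] using hz))
    nlinarith [norm_nonneg (z - x₀)]
  by_cases hztop : g z = ⊤
  · simp [hztop]
  lift g z to ℝ using ⟨hztop, hg.ne_bot z⟩ with s hs
  have hpos : 0 < ‖z - x₀‖ := by linarith
  -- Compare `g` at `x₀`, at `z` and at the point where the segment joining them leaves the ball.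
  have hexit : x₀ + ‖z - x₀‖⁻¹ • (z - x₀) ∈ Metric.closedBall x₀ 1 := by
    simp [norm_smul, hpos.ne']
  have hseg := (hm _ hexit).trans (apply_add_smul_sub_le_of_convex_epigraph hg.convex hr hs.ge
    (inv_nonneg.2 hpos.le) (inv_le_one_of_one_le₀ hz))
  have hslope : m - r ≤ ‖z - x₀‖⁻¹ * (s - r) := by
    linarith [EReal.coe_le_coe_iff.1 hseg]
  rw [← div_eq_inv_mul, le_div_iff₀ hpos] at hslope
  exact EReal.coe_le_coe_iff.2 (by linarith)

lemma IsProperClosedConvex.exists_coe_sub_mul_norm_le [FiniteDimensional ℝ X]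
    (hg : IsProperClosedConvex g) (x : X) :
    ∃ m c : ℝ, ∀ z, ((m - c * ‖z - x‖ : ℝ) : EReal) ≤ g z := by
  obtain ⟨x₀, hx₀⟩ := hg.exists_ne_top
  obtain ⟨m, hm⟩ := hg.exists_coe_le_of_isCompact (isCompact_closedBall x₀ 1)
  have hr := EReal.le_coe_toReal hx₀
  have hc : 0 ≤ (g x₀).toReal - m :=
    sub_nonneg.2 (EReal.coe_le_coe_iff.1 ((hm x₀ (by simp)).trans hr))
  refine ⟨m - ((g x₀).toReal - m) * ‖x - x₀‖, (g x₀).toReal - m, fun z =>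
    le_trans (EReal.coe_le_coe_iff.2 ?_) (hg.coe_sub_mul_norm_le hr hm z)⟩
  linarith [mul_le_mul_of_nonneg_left (norm_sub_le_norm_sub_add_norm_sub z x x₀) hc]

lemma tendsto_half_sq_add_sub_mul_atTop (m c : ℝ) :
    Tendsto (fun t : ℝ => 1 / 2 * t ^ 2 + (m - c * t)) atTop atTop := by
  have hprod : Tendsto (fun t : ℝ => t * (1 / 2 * t + -c)) atTop atTop :=
    tendsto_id.atTop_mul_atTop₀
      (tendsto_atTop_add_const_right _ _ (tendsto_id.const_mul_atTop (by norm_num)))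
  exact (tendsto_atTop_add_const_right _ m hprod).congr fun t => by ring

lemma IsProperClosedConvex.exists_isProxPoint [FiniteDimensional ℝ X]
    (hg : IsProperClosedConvex g) (x : X) : ∃ p, IsProxPoint g x p := by
  obtain ⟨x₀, hx₀⟩ := hg.exists_ne_top
  obtain ⟨m, c, hmc⟩ := hg.exists_coe_sub_mul_norm_le x
  have hlsc : LowerSemicontinuous fun z => (((1 / 2) * ‖z - x‖ ^ 2 : ℝ) : EReal) + g z := by
    refine LowerSemicontinuous.add' ?_ hg.closed fun z =>
      EReal.continuousAt_add (Or.inl (EReal.coe_ne_top _)) (Or.inl (EReal.coe_ne_bot _))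
    exact (continuous_coe_real_ereal.comp (by fun_prop)).lowerSemicontinuous
  have hnorm : Tendsto (fun z => ‖z - x‖) (cocompact X) atTop :=
    tendsto_norm_cocompact_atTop.comp (Homeomorph.subRight x).isClosedEmbedding.tendsto_cocompact
  refine exists_forall_le_of_lowerSemicontinuous hlsc x₀ ?_
  filter_upwards [((tendsto_half_sq_add_sub_mul_atTop m c).comp hnorm).eventually_ge_atTop
    (1 / 2 * ‖x₀ - x‖ ^ 2 + (g x₀).toReal)] with z hz
  calc (((1 / 2) * ‖x₀ - x‖ ^ 2 : ℝ) : EReal) + g x₀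
      ≤ ((1 / 2 * ‖x₀ - x‖ ^ 2 + (g x₀).toReal : ℝ) : EReal) := by
        rw [EReal.coe_add]
        gcongr
        exact EReal.le_coe_toReal hx₀
    _ ≤ ((1 / 2 * ‖z - x‖ ^ 2 + (m - c * ‖z - x‖) : ℝ) : EReal) := EReal.coe_le_coe_iff.2 hz
    _ ≤ (((1 / 2) * ‖z - x‖ ^ 2 : ℝ) : EReal) + g z := by
        rw [EReal.coe_add]
        gcongr
        exact hmc z

omit [InnerProductSpace ℝ X] in
lemma IsProxPoint.ne_top {x p : X} (hp : IsProxPoint g x p) (hg : ∃ z, g z ≠ ⊤) : g p ≠ ⊤ := by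
  intro htop
  obtain ⟨z, hz⟩ := hg
  have hle := hp z
  rw [htop, EReal.coe_add_top, top_le_iff] at hle
  exact EReal.add_ne_top (EReal.coe_ne_top _) hz hle

/-- In other words, `x - p` is a subgradient of `g` at `p`. -/
lemma IsProxPoint.inner_add_sub_nonneg {x p q : X} (hp : IsProxPoint g x p)
    (hg : Convex ℝ {p : X × ℝ | g p.1 ≤ (p.2 : EReal)}) {r s : ℝ} (hr : g p = r) (hs : g q = s) :
    0 ≤ inner ℝ (p - x) (q - p) + (s - r) := by
  have hslope : ∀ t ∈ Set.Ioc (0 : ℝ) 1,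
      0 ≤ (inner ℝ (p - x) (q - p) + (s - r)) + t * (‖q - p‖ ^ 2 / 2) := by
    rintro t ⟨ht0, ht1⟩
    have hmin := (hp (p + t • (q - p))).trans (add_le_add_right
      (apply_add_smul_sub_le_of_convex_epigraph hg hr.le hs.le ht0.le ht1) _)
    rw [hr, ← EReal.coe_add, ← EReal.coe_add, EReal.coe_le_coe_iff, add_sub_right_comm,
      norm_add_sq_real, inner_smul_right, norm_smul, Real.norm_of_nonneg ht0.le] at hmin
    refine (mul_nonneg_iff_of_pos_left ht0).1 ?_
    linarith
  have hlim : Tendsto (fun t => (inner ℝ (p - x) (q - p) + (s - r)) + t * (‖q - p‖ ^ 2 / 2))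
      (𝓝[>] 0) (𝓝 (inner ℝ (p - x) (q - p) + (s - r))) :=
    (Continuous.tendsto' (by fun_prop) _ _ (by simp)).mono_left nhdsWithin_le_nhds
  exact ge_of_tendsto hlim (by filter_upwards [Ioc_mem_nhdsGT one_pos] using hslope)

lemma IsProxPoint.norm_sub_le {x x' p p' : X} (hp : IsProxPoint g x p)
    (hp' : IsProxPoint g x' p') (hg : IsProperClosedConvex g) : ‖p - p'‖ ≤ ‖x - x'‖ := by
  have hr := (EReal.coe_toReal (hp.ne_top hg.exists_ne_top) (hg.ne_bot p)).symm
  have hr' := (EReal.coe_toReal (hp'.ne_top hg.exists_ne_top) (hg.ne_bot p')).symm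
  have hsum : inner ℝ (p - x) (p' - p) + inner ℝ (p' - x') (p - p')
      = inner ℝ (x - x') (p - p') - ‖p - p'‖ ^ 2 := by
    rw [← real_inner_self_eq_norm_sq, ← neg_sub p p', inner_neg_right, ← inner_neg_left,
      ← inner_add_left, ← inner_sub_left]
    congr 1
    abel
  have hfirm : ‖p - p'‖ ^ 2 ≤ inner ℝ (x - x') (p - p') := by
    linarith [hp.inner_add_sub_nonneg hg.convex hr hr', hp'.inner_add_sub_nonneg hg.convex hr' hr]
  have hcauchy : ‖p - p'‖ * ‖p - p'‖ ≤ ‖x - x'‖ * ‖p - p'‖ := by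
    linarith [real_inner_le_norm (x - x') (p - p')]
  by_contra! hlt
  exact hcauchy.not_gt (mul_lt_mul_of_pos_right hlt ((norm_nonneg _).trans_lt hlt))

variable [FiniteDimensional ℝ X]

lemma IsProperClosedConvex.existsUnique_isProxPoint (hg : IsProperClosedConvex g) (x : X) :
    ∃! p, IsProxPoint g x p := by
  obtain ⟨p, hp⟩ := hg.exists_isProxPoint x
  refine ⟨p, hp, fun q hq => sub_eq_zero.1 (norm_le_zero_iff.1 ?_)⟩
  simpa using hq.norm_sub_le hp hg

lemma IsProperClosedConvex.isProxPoint_prox (hg : IsProperClosedConvex g) (x : X) :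
    IsProxPoint g x (prox g x) := by
  have h := hg.exists_isProxPoint x
  rw [prox, dif_pos h]
  exact h.choose_spec

lemma IsProperClosedConvex.lipschitzWith_prox (hg : IsProperClosedConvex g) :
    LipschitzWith 1 (prox g) :=
  LipschitzWith.mk_one fun x x' => by
    simpa only [dist_eq_norm] using (hg.isProxPoint_prox x).norm_sub_le (hg.isProxPoint_prox x') hg

end Prox

section LocallyLipschitz

variable {α β γ : Type*} [PseudoEMetricSpace α] [PseudoEMetricSpace β] [PseudoEMetricSpace γ]
  {s : Set α}

lemma exists_lipschitzOnWith_nhds {f : α → β} {x : α} (hf : LocallyLipschitzOn s f)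
    (hs : s ∈ 𝓝 x) : ∃ K, ∃ u ∈ 𝓝 x, LipschitzOnWith K f u := by
  simpa only [nhdsWithin_eq_nhds.2 hs] using hf (mem_of_mem_nhds hs)

lemma locallyLipschitzOn_comp {f : α → β} {g : β → γ} {t : Set β} (hg : LocallyLipschitzOn t g)
    (hf : LocallyLipschitzOn s f) (hst : Set.MapsTo f s t) :
    LocallyLipschitzOn s (fun x => g (f x)) := by
  intro x hx
  obtain ⟨K, u, hu, hfu⟩ := hf hx
  obtain ⟨L, v, hv, hgv⟩ := hg (hst hx)
  have hpre : f ⁻¹' v ∈ 𝓝[s] x := (hf.continuousOn x hx).tendsto_nhdsWithin hst hv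
  exact ⟨L * K, u ∩ f ⁻¹' v, inter_mem hu hpre,
    hgv.comp (hfu.mono Set.inter_subset_left) fun _ hy => hy.2⟩

lemma locallyLipschitzOn_locallyLipschitz_comp {f : α → β} {g : β → γ} (hg : LocallyLipschitz g)
    (hf : LocallyLipschitzOn s f) : LocallyLipschitzOn s (fun x => g (f x)) :=
  locallyLipschitzOn_comp (locallyLipschitzOn_univ.2 hg) hf (Set.mapsTo_univ f s)

lemma locallyLipschitzOn_prodMk {f : α → β} {g : α → γ} (hf : LocallyLipschitzOn s f)
    (hg : LocallyLipschitzOn s g) : LocallyLipschitzOn s (fun x => (f x, g x)) := by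
  intro x hx
  obtain ⟨K, u, hu, hfu⟩ := hf hx
  obtain ⟨L, v, hv, hgv⟩ := hg hx
  exact ⟨max K L, u ∩ v, inter_mem hu hv,
    (hfu.mono Set.inter_subset_left).prodMk (hgv.mono Set.inter_subset_right)⟩

lemma locallyLipschitzOn_pi {ι : Type*} [Fintype ι] {f : α → ι → β}
    (hf : ∀ i, LocallyLipschitzOn s (fun x => f x i)) : LocallyLipschitzOn s f := by
  intro x hx
  choose K u hu hfu using fun i => hf i hx
  refine ⟨Finset.univ.sup K, ⋂ i, u i, iInter_mem.2 hu, fun y hy z hz => edist_pi_le_iff.2 fun i =>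
    (hfu i (Set.mem_iInter.1 hy i) (Set.mem_iInter.1 hz i)).trans ?_⟩
  gcongr
  exact Finset.le_sup (Finset.mem_univ i)

end LocallyLipschitz

lemma locallyLipschitzOn_atObs_comp {α A T B Y : Type*} [PseudoEMetricSpace α]
    [NormedAddCommGroup A] [NormedAddCommGroup T] [NormedAddCommGroup B] {s : Set α}
    {Ω : Set T} {h : A → Y → T → B} {y : Y} {u : α → A} {v : α → T}
    (hh : LocallyLipschitzOn (Set.univ ×ˢ Ω) (atObs h y)) (hu : LocallyLipschitzOn s u)
    (hv : LocallyLipschitzOn s v) (hvΩ : Set.MapsTo v s Ω) :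
    LocallyLipschitzOn s (fun p => h (u p) y (v p)) :=
  locallyLipschitzOn_comp hh (locallyLipschitzOn_prodMk hu hv) fun _ hp => ⟨trivial, hvΩ hp⟩

lemma locallyLipschitzOn_atObs_of_lipschitzWith {A T B Y : Type*}
    [NormedAddCommGroup A] [NormedAddCommGroup T] [NormedAddCommGroup B]
    {Ω : Set T} {h : A → Y → T → B} {y : Y} {L : ℝ≥0}
    (hL : ∀ θ ∈ Ω, LipschitzWith L (fun a => h a y θ))
    (hh : LocallyLipschitzInParam Ω (fun a θ => h a y θ)) :
    LocallyLipschitzOn (Set.univ ×ˢ Ω) (atObs h y) := by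
  rintro ⟨a₀, θ₀⟩ ⟨-, hθ₀⟩
  obtain ⟨K, U, hU, V, hV, hK⟩ := hh a₀ θ₀ hθ₀
  refine ⟨L + K, U ×ˢ (V ∩ Ω), ?_, LipschitzOnWith.of_dist_le_mul ?_⟩
  · rw [nhdsWithin_prod_eq, nhdsWithin_univ]
    exact prod_mem_prod hU (inter_mem (mem_nhdsWithin_of_mem_nhds hV) self_mem_nhdsWithin)
  rintro ⟨a, θ⟩ ⟨-, hθ⟩ ⟨a', θ'⟩ ⟨ha', hθ'⟩
  calc dist (h a y θ) (h a' y θ')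
      ≤ dist (h a y θ) (h a' y θ) + dist (h a' y θ) (h a' y θ') := dist_triangle _ _ _
    _ ≤ L * dist a a' + K * dist θ θ' :=
        add_le_add ((hL θ hθ.2).dist_le_mul a a') ((hK a' ha').dist_le_mul θ hθ θ' hθ')
    _ ≤ L * dist (a, θ) (a', θ') + K * dist (a, θ) (a', θ') := by
        gcongr
        · exact le_max_left _ _
        · exact le_max_right _ _
    _ = (L + K : ℝ≥0) * dist (a, θ) (a', θ') := by rw [NNReal.coe_add, add_mul]

lemma exists_lipschitzWith_eventuallyEq {α : Type*} [MetricSpace α] [LocallyCompactSpace α]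
    {Ω K : Set α} {f : α → ℝ} (hΩ : IsOpen Ω) (hf : LocallyLipschitzOn Ω f) (hK : IsCompact K)
    (hKΩ : K ⊆ Ω) : ∃ C, ∃ g : α → ℝ, LipschitzWith C g ∧ ∀ x ∈ K, g =ᶠ[𝓝 x] f := by
  obtain ⟨K', hK', hKK', hK'Ω⟩ := exists_compact_between hK hΩ hKΩ
  obtain ⟨C, hC⟩ := (hf.mono hK'Ω).exists_lipschitzOnWith_of_compact hK'
  obtain ⟨g, hg, hfg⟩ := hC.extend_real
  exact ⟨C, g, hg, fun x hx => hfg.symm.eventuallyEq_of_mem (mem_interior_iff_mem_nhds.1 (hKK' hx))⟩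

section WeakJacobian

lemma integrableOn_smul_of_tsupport_subset {α E : Type*} [TopologicalSpace α] [T2Space α]
    [MeasurableSpace α] [OpensMeasurableSpace α] {μ : Measure α} [NormedAddCommGroup E]
    [NormedSpace ℝ E] {Ω : Set α} {w : α → E} {φ : α → ℝ} (hΩ : MeasurableSet Ω)
    (hw : LocallyIntegrableOn w Ω μ) (hφ : Continuous φ) (hφc : HasCompactSupport φ)
    (hφs : tsupport φ ⊆ Ω) : IntegrableOn (fun x => φ x • w x) Ω μ := by
  have hK : IntegrableOn (fun x => φ x • w x) (tsupport φ) μ :=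
    (hw.integrableOn_compact_subset hφs hφc).continuousOn_smul hφ.continuousOn hφc
  exact hK.of_forall_sdiff_eq_zero hΩ fun x hx => by
    rw [image_eq_zero_of_notMem_tsupport hx.2, zero_smul]

section Haar

variable {T E : Type*} [NormedAddCommGroup T] [NormedSpace ℝ T] [FiniteDimensional ℝ T]
  [MeasurableSpace T] [BorelSpace T] {μ : Measure T} [NormedAddCommGroup E] [NormedSpace ℝ E]
  {Ω : Set T}

lemma ae_differentiableAt_of_locallyLipschitzOn [μ.IsAddHaarMeasure] [FiniteDimensional ℝ E]
    {f : T → E} (hΩ : IsOpen Ω) (hf : LocallyLipschitzOn Ω f) :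
    ∀ᵐ θ ∂(μ.restrict Ω), DifferentiableAt ℝ f θ := by
  rw [ae_iff, Measure.restrict_apply₀' hΩ.measurableSet.nullMeasurableSet]
  refine measure_null_of_locally_null _ fun x hx => ?_
  obtain ⟨K, u, hu, hfu⟩ := exists_lipschitzOnWith_nhds hf (hΩ.mem_nhds hx.2)
  refine ⟨_, inter_mem_nhdsWithin _ (interior_mem_nhds.2 hu),
    measure_mono_null ?_ (ae_iff.1 (hfu.ae_differentiableWithinAt_of_mem (μ := μ)))⟩
  rintro θ ⟨⟨hθ, -⟩, hθu⟩ hdiff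
  exact hθ ((hdiff (interior_subset hθu)).differentiableAt (mem_interior_iff_mem_nhds.1 hθu))

lemma locallyIntegrableOn_fderiv [IsLocallyFiniteMeasure μ] [FiniteDimensional ℝ E]
    {f : T → E} (hΩ : IsOpen Ω) (hf : LocallyLipschitzOn Ω f) :
    LocallyIntegrableOn (fderiv ℝ f) Ω μ := by
  intro x hx
  have : CompleteSpace E := FiniteDimensional.complete ℝ E
  have : ProperSpace (T →L[ℝ] E) := FiniteDimensional.proper_real _
  borelize (T →L[ℝ] E)
  obtain ⟨K, u, hu, hfu⟩ := exists_lipschitzOnWith_nhds hf (hΩ.mem_nhds hx)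
  have hbound : ∀ᶠ θ in 𝓝 x, ‖fderiv ℝ f θ‖ ≤ K := by
    filter_upwards [eventually_mem_nhds_iff.2 hu] with θ hθ using
      norm_fderiv_le_of_lipschitzOn ℝ hθ hfu
  exact ((μ.finiteAt_nhds x).integrableAtFilter
    (measurable_fderiv ℝ f).aestronglyMeasurable.stronglyMeasurableAtFilter
    (isBoundedUnder_of_eventually_le hbound)).filter_mono nhdsWithin_le_nhds

lemma setIntegral_smul_fderiv_eq_neg [μ.IsAddHaarMeasure] {f φ : T → ℝ} (hΩ : IsOpen Ω)
    (hf : LocallyLipschitzOn Ω f) (hφ : ContDiff ℝ 1 φ) (hφc : HasCompactSupport φ)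
    (hφs : tsupport φ ⊆ Ω) (v : T) :
    ∫ θ in Ω, φ θ • fderiv ℝ f θ v ∂μ = -∫ θ in Ω, fderiv ℝ φ θ v • f θ ∂μ := by
  obtain ⟨C, g, hg, hgf⟩ := exists_lipschitzWith_eventuallyEq hΩ hf hφc hφs
  obtain ⟨D, hD⟩ := hφ.lipschitzWith_of_hasCompactSupport hφc one_ne_zero
  have hφ_zero {θ : T} (hθ : θ ∉ tsupport φ) : φ θ = 0 := image_eq_zero_of_notMem_tsupport hθ
  have hfderivφ_zero {θ : T} (hθ : θ ∉ tsupport φ) : fderiv ℝ φ θ v = 0 := by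
    rw [fderiv_of_notMem_tsupport ℝ hθ, zero_apply]
  calc ∫ θ in Ω, φ θ • fderiv ℝ f θ v ∂μ
      = ∫ θ, φ θ • fderiv ℝ f θ v ∂μ :=
        setIntegral_eq_integral_of_forall_compl_eq_zero fun θ hθ => by
          rw [hφ_zero (mt (@hφs θ) hθ), zero_smul]
    _ = ∫ θ, lineDeriv ℝ g θ v * φ θ ∂μ := by
        refine integral_congr_ae ?_
        filter_upwards [hg.ae_differentiableAt (μ := μ)] with θ hgθ
        by_cases hθ : θ ∈ tsupport φ
        · rw [hgθ.lineDeriv_eq_fderiv, (hgf θ hθ).fderiv_eq, smul_eq_mul, mul_comm]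
        · rw [hφ_zero hθ, zero_smul, mul_zero]
    _ = ∫ θ, lineDeriv ℝ φ θ (-v) * g θ ∂μ := hg.integral_lineDeriv_mul_eq hD hφc v
    _ = -∫ θ, fderiv ℝ φ θ v • f θ ∂μ := by
        rw [← integral_neg]
        refine integral_congr_ae (ae_of_all μ fun θ => ?_)
        simp only [(hφ.differentiable one_ne_zero θ).lineDeriv_eq_fderiv, map_neg, smul_eq_mul,
          neg_mul]
        by_cases hθ : θ ∈ tsupport φ
        · rw [(hgf θ hθ).self_of_nhds]
        · rw [hfderivφ_zero hθ, zero_mul, zero_mul]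
    _ = -∫ θ in Ω, fderiv ℝ φ θ v • f θ ∂μ := by
        rw [setIntegral_eq_integral_of_forall_compl_eq_zero fun θ hθ => by
          rw [hfderivφ_zero (mt (@hφs θ) hθ), zero_smul]]

end Haar

variable {T E : Type*} [NormedAddCommGroup T] [InnerProductSpace ℝ T] [FiniteDimensional ℝ T]
  [MeasurableSpace T] [BorelSpace T] [NormedAddCommGroup E] [NormedSpace ℝ E]
  {Ω : Set T} {f : T → E} {J J' : T → T →L[ℝ] E}

lemma integrableOn_smul_clm_apply {φ : T → ℝ} (hΩ : IsOpen Ω) (hJ : LocallyIntegrableOn J Ω)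
    (hφ : Continuous φ) (hφc : HasCompactSupport φ) (hφs : tsupport φ ⊆ Ω) (v : T) :
    IntegrableOn (fun θ => φ θ • J θ v) Ω :=
  (ContinuousLinearMap.apply ℝ E v).integrable_comp
    (integrableOn_smul_of_tsupport_subset hΩ.measurableSet hJ hφ hφc hφs)

lemma isWeakJacobian_fderiv [FiniteDimensional ℝ E] (hΩ : IsOpen Ω)
    (hf : LocallyLipschitzOn Ω f) : IsWeakJacobian Ω f (fderiv ℝ f) := by
  have : CompleteSpace E := FiniteDimensional.complete ℝ E
  have hfi : LocallyIntegrableOn f Ω := hf.continuousOn.locallyIntegrableOn hΩ.measurableSet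
  have hJi : LocallyIntegrableOn (fderiv ℝ f) Ω := locallyIntegrableOn_fderiv hΩ hf
  refine ⟨hfi, hJi, fun φ hφ hφc hφs v => ?_⟩
  have hint : IntegrableOn (fun θ => φ θ • fderiv ℝ f θ v) Ω :=
    integrableOn_smul_clm_apply hΩ hJi hφ.continuous hφc hφs v
  have hint' : IntegrableOn (fun θ => fderiv ℝ φ θ v • f θ) Ω :=
    integrableOn_smul_of_tsupport_subset hΩ.measurableSet hfi
      ((hφ.continuous_fderiv one_ne_zero).clm_apply continuous_const)
      (hφc.fderiv_apply ℝ v) ((tsupport_fderiv_apply_subset ℝ v).trans hφs)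
  refine (SeparatingDual.eq_iff_forall_dual_eq (R := ℝ)).2 fun L => ?_
  calc L (∫ θ in Ω, φ θ • fderiv ℝ f θ v)
      = ∫ θ in Ω, L (φ θ • fderiv ℝ f θ v) := (L.integral_comp_comm hint).symm
    _ = ∫ θ in Ω, φ θ • fderiv ℝ (fun θ => L (f θ)) θ v := by
        refine integral_congr_ae ?_
        filter_upwards [ae_differentiableAt_of_locallyLipschitzOn hΩ hf] with θ hθ
        have hLf : HasFDerivAt (fun θ => L (f θ)) (L ∘L fderiv ℝ f θ) θ :=
          L.hasFDerivAt.comp θ hθ.hasFDerivAt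
        rw [map_smul, hLf.fderiv, ContinuousLinearMap.comp_apply]
    _ = -∫ θ in Ω, fderiv ℝ φ θ v • L (f θ) := setIntegral_smul_fderiv_eq_neg hΩ
        (locallyLipschitzOn_locallyLipschitz_comp L.lipschitz.locallyLipschitz hf) hφ hφc hφs v
    _ = L (-∫ θ in Ω, fderiv ℝ φ θ v • f θ) := by
        simp_rw [map_neg, ← L.integral_comp_comm hint', map_smul]

lemma IsWeakJacobian.ae_eq [CompleteSpace E] (hJ : IsWeakJacobian Ω f J)
    (hJ' : IsWeakJacobian Ω f J') (hΩ : IsOpen Ω) : ∀ᵐ θ ∂(volume.restrict Ω), J θ = J' θ := by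
  rw [ae_restrict_iff' hΩ.measurableSet]
  have hdiff : ∀ᵐ θ, θ ∈ Ω → J θ - J' θ = 0 := by
    refine hΩ.ae_eq_zero_of_integral_contDiff_smul_eq_zero (hJ.2.1.sub hJ'.2.1)
      fun φ hφ hφc hφs => ?_
    have hφ₁ : ContDiff ℝ 1 φ := hφ.of_le (by exact_mod_cast le_top)
    have hint := integrableOn_smul_of_tsupport_subset hΩ.measurableSet hJ.2.1 hφ.continuous hφc hφs
    have hint' :=
      integrableOn_smul_of_tsupport_subset hΩ.measurableSet hJ'.2.1 hφ.continuous hφc hφs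
    have hoff : ∀ θ ∉ Ω, φ θ • (J θ - J' θ) = 0 := fun θ hθ => by
      rw [image_eq_zero_of_notMem_tsupport (mt (@hφs θ) hθ), zero_smul]
    rw [← setIntegral_eq_integral_of_forall_compl_eq_zero hoff]
    simp_rw [smul_sub]
    rw [integral_sub hint hint', sub_eq_zero]
    ext v
    rw [ContinuousLinearMap.integral_apply hint, ContinuousLinearMap.integral_apply hint']
    exact (hJ.2.2 φ hφ₁ hφc hφs v).trans (hJ'.2.2 φ hφ₁ hφc hφs v).symm
  filter_upwards [hdiff] with θ hθ hθΩ using sub_eq_zero.1 (hθ hθΩ)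

lemma IsWeakJacobian.ae_hasFDerivAt [FiniteDimensional ℝ E] (hJ : IsWeakJacobian Ω f J)
    (hΩ : IsOpen Ω) (hf : LocallyLipschitzOn Ω f) :
    ∀ᵐ θ ∂(volume.restrict Ω), HasFDerivAt f (J θ) θ := by
  have : CompleteSpace E := FiniteDimensional.complete ℝ E
  filter_upwards [hJ.ae_eq (isWeakJacobian_fderiv hΩ hf) hΩ,
    ae_differentiableAt_of_locallyLipschitzOn hΩ hf] with θ hθ hdiff
  rw [hθ]
  exact hdiff.hasFDerivAt

end WeakJacobian

section ChainRule

/-- A Lipschitz map changes by `o(t)` when the curve `c` is replaced by its tangent line, whose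
distance to `c t` is `o(t)`. -/
lemma hasLineDerivAt_of_hasDerivAt_comp {𝕜 E B : Type*} [NontriviallyNormedField 𝕜]
    [NormedAddCommGroup E] [NormedSpace 𝕜 E] [NormedAddCommGroup B] [NormedSpace 𝕜 B]
    {h : E → B} {K : ℝ≥0} {s : Set E} {c : 𝕜 → E} {c' : E} {w : B} (hh : LipschitzOnWith K h s)
    (hs : s ∈ 𝓝 (c 0)) (hc : HasDerivAt c c' 0) (hw : HasDerivAt (fun t => h (c t)) w 0) :
    HasLineDerivAt 𝕜 h w (c 0) c' := by
  have hline : HasDerivAt (fun t : 𝕜 => c 0 + t • c') c' 0 := by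
    simpa using ((hasDerivAt_id (0 : 𝕜)).smul_const c').const_add (c 0)
  have hgap : HasDerivAt (fun t : 𝕜 => c 0 + t • c' - c t) 0 0 := by
    simpa using hline.fun_sub hc
  have hhgap : HasDerivAt (fun t : 𝕜 => h (c 0 + t • c') - h (c t)) 0 0 := by
    rw [hasDerivAt_iff_isLittleO] at hgap ⊢
    refine (Asymptotics.IsBigO.of_bound K ?_).trans_isLittleO hgap
    have hline_mem : ∀ᶠ t in 𝓝 (0 : 𝕜), c 0 + t • c' ∈ s :=
      hline.continuousAt.eventually_mem (by simpa using hs)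
    filter_upwards [hc.continuousAt.eventually_mem hs, hline_mem] with t hct hlt
    simpa using hh.norm_sub_le hlt hct
  simpa [HasLineDerivAt] using hhgap.fun_add hw

variable {A T B Y : Type*} [NormedAddCommGroup A] [NormedSpace ℝ A] [NormedAddCommGroup T]
  [NormedSpace ℝ T] [NormedAddCommGroup B] [NormedSpace ℝ B]
  {h : A → Y → T → B} {y : Y} {u : T → A} {u' : T →L[ℝ] A} {w' : T →L[ℝ] B} {θ : T}

lemma hasLineDerivAt_atObs {Ω : Set T} (hh : LocallyLipschitzOn (Set.univ ×ˢ Ω) (atObs h y))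
    (hΩ : Ω ∈ 𝓝 θ) (hu : HasFDerivAt u u' θ) (hw : HasFDerivAt (fun θ => h (u θ) y θ) w' θ)
    (δ : T) : HasLineDerivAt ℝ (atObs h y) (w' δ) (u θ, θ) (u' δ, δ) := by
  obtain ⟨K, s, hs, hK⟩ := exists_lipschitzOnWith_nhds hh (prod_mem_nhds univ_mem hΩ)
  have hcurve : HasDerivAt (fun t : ℝ => (u (θ + t • δ), θ + t • δ)) (u' δ, δ) 0 :=
    (hu.prodMk (hasFDerivAt_id θ)).hasLineDerivAt δ
  simpa using hasLineDerivAt_of_hasDerivAt_comp hK (by simpa using hs) hcurve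
    (hw.hasLineDerivAt δ)

lemma eq_jac1_comp_add_jac3 (hh : DifferentiableAt ℝ (atObs h y) (u θ, θ))
    (hu : HasFDerivAt u u' θ) (hw : HasFDerivAt (fun θ => h (u θ) y θ) w' θ) :
    w' = jac1 h (u θ) y θ ∘L u' + jac3 h (u θ) y θ := by
  obtain ⟨H, hH⟩ := hh
  have hpartial₁ : jac1 h (u θ) y θ = H ∘L ContinuousLinearMap.inl ℝ A T :=
    (HasFDerivAt.comp (g := atObs h y) (f := (·, θ)) (u θ) hH
      (hasFDerivAt_prodMk_left (u θ) θ)).fderiv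
  have hpartial₃ : jac3 h (u θ) y θ = H ∘L ContinuousLinearMap.inr ℝ A T :=
    (HasFDerivAt.comp (g := atObs h y) θ hH (hasFDerivAt_prodMk_right (u θ) θ)).fderiv
  have htotal : w' = H ∘L u'.prod (ContinuousLinearMap.id ℝ T) :=
    hw.unique (HasFDerivAt.comp (g := atObs h y) (f := fun θ => (u θ, θ)) θ hH
      (hu.prodMk (hasFDerivAt_id θ)))
  rw [htotal, hpartial₁, hpartial₃]
  ext δ
  simp [← map_add]

end ChainRule

section Algorithm

variable {X Y T : Type*} [NormedAddCommGroup X] [InnerProductSpace ℝ X] [NormedAddCommGroup T]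
  {Ω : Set T} {y : Y} {Q : ℕ} {ν : ℝ} {F : X → Y → T → ℝ} {G : Fin Q → X → Y → T → EReal}

lemma locallyLipschitzOn_proxG [FiniteDimensional ℝ X] (hQ : 0 < Q) (hν : 0 < ν) {k : Fin Q}
    (hG : ∀ θ ∈ Ω, IsProperClosedConvex (fun x => G k x y θ))
    (hGlip : LocallyLipschitzInParam Ω (fun x θ => proxG ν G k x y θ)) :
    LocallyLipschitzOn (Set.univ ×ˢ Ω) (atObs (proxG ν G k) y) :=
  locallyLipschitzOn_atObs_of_lipschitzWith
    (fun θ hθ => ((hG θ hθ).const_mul (by positivity)).lipschitzWith_prox) hGlip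

variable [CompleteSpace X]

section Lipschitz

variable {α : Type*} [PseudoEMetricSpace α] {s : Set α} {a : α → X × (Fin Q → X)} {v : α → T}

lemma locallyLipschitzOn_zarg (hF : LocallyLipschitzOn (Set.univ ×ˢ Ω) (atObs (grad1 F) y))
    (ha : LocallyLipschitzOn s a) (hv : LocallyLipschitzOn s v) (hvΩ : Set.MapsTo v s Ω)
    (k : Fin Q) : LocallyLipschitzOn s (fun p => zarg F ν k (a p) y (v p)) := by
  have hx : LocallyLipschitzOn s (fun p => (a p).1) :=
    locallyLipschitzOn_locallyLipschitz_comp LipschitzWith.prod_fst.locallyLipschitz ha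
  have hlin : LocallyLipschitzOn s (fun p => (2 : ℝ) • (a p).1 - (a p).2 k) :=
    locallyLipschitzOn_locallyLipschitz_comp
      (g := fun a : X × (Fin Q → X) => (2 : ℝ) • a.1 - a.2 k)
      (ContDiff.locallyLipschitz (𝕂 := ℝ) (by fun_prop)) ha
  exact hlin.sub (locallyLipschitzOn_locallyLipschitz_comp (lipschitzWith_smul ν).locallyLipschitz
    (locallyLipschitzOn_atObs_comp hF hx hv hvΩ))

lemma locallyLipschitzOn_psi (hF : LocallyLipschitzOn (Set.univ ×ˢ Ω) (atObs (grad1 F) y))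
    (hP : ∀ k, LocallyLipschitzOn (Set.univ ×ˢ Ω) (atObs (proxG ν G k) y))
    (ha : LocallyLipschitzOn s a) (hv : LocallyLipschitzOn s v) (hvΩ : Set.MapsTo v s Ω) :
    LocallyLipschitzOn s (fun p => psi F G ν (a p) y (v p)) := by
  have hlin (k : Fin Q) : LocallyLipschitzOn s (fun p => (a p).2 k - (a p).1) :=
    locallyLipschitzOn_locallyLipschitz_comp (g := fun a : X × (Fin Q → X) => a.2 k - a.1)
      (ContDiff.locallyLipschitz (𝕂 := ℝ) (by fun_prop)) ha
  have hznext (k : Fin Q) : LocallyLipschitzOn s (fun p => znext F G ν k (a p) y (v p)) :=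
    (hlin k).add (locallyLipschitzOn_atObs_comp (hP k)
      (locallyLipschitzOn_zarg hF ha hv hvΩ k) hv hvΩ)
  exact locallyLipschitzOn_locallyLipschitz_comp
    (g := fun z : Fin Q → X => ((1 / (Q : ℝ)) • ∑ k, z k, z))
    (ContDiff.locallyLipschitz (𝕂 := ℝ) (by fun_prop)) (locallyLipschitzOn_pi hznext)

lemma locallyLipschitzOn_iter (hF : LocallyLipschitzOn (Set.univ ×ˢ Ω) (atObs (grad1 F) y))
    (hP : ∀ k, LocallyLipschitzOn (Set.univ ×ˢ Ω) (atObs (proxG ν G k) y))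
    {a₀ : Y → T → X × (Fin Q → X)} (ha₀ : LocallyLipschitzOn Ω (a₀ y)) (ℓ : ℕ) :
    LocallyLipschitzOn Ω (iter F G ν a₀ ℓ y) := by
  induction ℓ with
  | zero => exact ha₀
  | succ ℓ ih =>
    exact locallyLipschitzOn_psi hF hP ih LocallyLipschitz.id.locallyLipschitzOn (Set.mapsTo_id Ω)

end Lipschitz

section Recursion

variable [NormedSpace ℝ T] {k : Fin Q} {a : T → X × (Fin Q → X)} {θ : T}
  {Jx Jz Jz' JZ : T →L[ℝ] X}

lemma hasFDerivAt_proxG_zarg (hx : HasFDerivAt (fun θ => gam (a θ)) Jx θ)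
    (hz : HasFDerivAt (fun θ => (a θ).2 k) Jz θ)
    (hz' : HasFDerivAt (fun θ => znext F G ν k (a θ) y θ) Jz' θ) :
    HasFDerivAt (fun θ => proxG ν G k (zarg F ν k (a θ) y θ) y θ) (Jz' - Jz + Jx) θ := by
  convert (hz'.fun_sub hz).fun_add hx using 2 with θ'
  simp only [znext, gam]
  abel

lemma znext_fderiv_apply_eq_lineDeriv
    (hP : LocallyLipschitzOn (Set.univ ×ˢ Ω) (atObs (proxG ν G k) y)) (hΩ : Ω ∈ 𝓝 θ)
    (hx : HasFDerivAt (fun θ => gam (a θ)) Jx θ) (hz : HasFDerivAt (fun θ => (a θ).2 k) Jz θ)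
    (hz' : HasFDerivAt (fun θ => znext F G ν k (a θ) y θ) Jz' θ)
    (hZ : HasFDerivAt (fun θ => zarg F ν k (a θ) y θ) JZ θ) (δ : T) :
    LineDifferentiableAt ℝ (atObs (proxG ν G k) y) (zarg F ν k (a θ) y θ, θ) (JZ δ, δ) ∧
      Jz' δ = Jz δ - Jx δ +
        lineDeriv ℝ (atObs (proxG ν G k) y) (zarg F ν k (a θ) y θ, θ) (JZ δ, δ) := by
  have hline := hasLineDerivAt_atObs hP hΩ hZ (hasFDerivAt_proxG_zarg hx hz hz') δ
  refine ⟨hline.lineDifferentiableAt, ?_⟩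
  rw [hline.lineDeriv]
  simp

lemma znext_fderiv_eq_jac (hP : DifferentiableAt ℝ (atObs (proxG ν G k) y)
      (zarg F ν k (a θ) y θ, θ))
    (hx : HasFDerivAt (fun θ => gam (a θ)) Jx θ) (hz : HasFDerivAt (fun θ => (a θ).2 k) Jz θ)
    (hz' : HasFDerivAt (fun θ => znext F G ν k (a θ) y θ) Jz' θ)
    (hZ : HasFDerivAt (fun θ => zarg F ν k (a θ) y θ) JZ θ) :
    Jz' = Jz - Jx + jac1 (proxG ν G k) (zarg F ν k (a θ) y θ) y θ ∘L JZ
      + jac3 (proxG ν G k) (zarg F ν k (a θ) y θ) y θ := by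
  have hchain : Jz' - Jz + Jx = jac1 (proxG ν G k) (zarg F ν k (a θ) y θ) y θ ∘L JZ
      + jac3 (proxG ν G k) (zarg F ν k (a θ) y θ) y θ :=
    eq_jac1_comp_add_jac3 (u := fun θ => zarg F ν k (a θ) y θ) hP hZ
      (hasFDerivAt_proxG_zarg hx hz hz')
  rw [add_assoc, ← hchain]
  abel

lemma hasFDerivAt_grad1 (hν : ν ≠ 0) (hx : HasFDerivAt (fun θ => gam (a θ)) Jx θ)
    (hz : HasFDerivAt (fun θ => (a θ).2 k) Jz θ)
    (hZ : HasFDerivAt (fun θ => zarg F ν k (a θ) y θ) JZ θ) :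
    HasFDerivAt (fun θ => grad1 F (gam (a θ)) y θ) (ν⁻¹ • ((2 : ℝ) • Jx - Jz - JZ)) θ := by
  convert (((hx.fun_const_smul (2 : ℝ)).fun_sub hz).fun_sub hZ).fun_const_smul ν⁻¹ using 2 with θ'
  rw [eq_inv_smul_iff₀ hν]
  simp only [zarg, gam]
  abel

lemma zarg_fderiv_apply_eq_lineDeriv (hν : ν ≠ 0)
    (hF : LocallyLipschitzOn (Set.univ ×ˢ Ω) (atObs (grad1 F) y)) (hΩ : Ω ∈ 𝓝 θ)
    (hx : HasFDerivAt (fun θ => gam (a θ)) Jx θ) (hz : HasFDerivAt (fun θ => (a θ).2 k) Jz θ)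
    (hZ : HasFDerivAt (fun θ => zarg F ν k (a θ) y θ) JZ θ) (δ : T) :
    LineDifferentiableAt ℝ (atObs (grad1 F) y) (gam (a θ), θ) (Jx δ, δ) ∧
      JZ δ = (2 : ℝ) • Jx δ - Jz δ -
        ν • lineDeriv ℝ (atObs (grad1 F) y) (gam (a θ), θ) (Jx δ, δ) := by
  have hline := hasLineDerivAt_atObs hF hΩ hx (hasFDerivAt_grad1 hν hx hz hZ) δ
  refine ⟨hline.lineDifferentiableAt, ?_⟩
  rw [hline.lineDeriv, smul_apply, smul_inv_smul₀ hν]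
  simp

lemma zarg_fderiv_eq_jac (hν : ν ≠ 0)
    (hF : DifferentiableAt ℝ (atObs (grad1 F) y) (gam (a θ), θ))
    (hx : HasFDerivAt (fun θ => gam (a θ)) Jx θ) (hz : HasFDerivAt (fun θ => (a θ).2 k) Jz θ)
    (hZ : HasFDerivAt (fun θ => zarg F ν k (a θ) y θ) JZ θ) :
    JZ = (2 : ℝ) • Jx - Jz - ν • (jac1 (grad1 F) (gam (a θ)) y θ ∘L Jx
      + jac3 (grad1 F) (gam (a θ)) y θ) := by
  rw [← eq_jac1_comp_add_jac3 hF hx (hasFDerivAt_grad1 hν hx hz hZ), smul_inv_smul₀ hν]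
  abel

end Recursion

end Algorithm

end GFB

theorem mainTheorem9_general
    {X : Type*} [NormedAddCommGroup X] [InnerProductSpace ℝ X] [FiniteDimensional ℝ X]
    [CompleteSpace X]
    {Y : Type*}
    {T : Type*} [NormedAddCommGroup T] [InnerProductSpace ℝ T] [FiniteDimensional ℝ T]
    [MeasurableSpace T] [BorelSpace T]
    (Ω : Set T) (hΩ : IsOpen Ω) (y : Y)
    (Q : ℕ) (hQ : 0 < Q) (ν : ℝ) (hν : ν ≠ 0)
    (F : X → Y → T → ℝ) (G : Fin Q → X → Y → T → EReal)
    (a₀ : Y → T → X × (Fin Q → X))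
    (hF : ∀ θ ∈ Ω, ContDiff ℝ 1 (fun x => F x y θ))
    (hFlip : LocallyLipschitzOn (Set.univ ×ˢ Ω) (GFB.atObs (GFB.grad1 F) y))
    (hprox : ∀ k, ∀ θ ∈ Ω, ∀ x, ∃! p, GFB.IsProxPoint
      (fun z => ((ν * (Q : ℝ) : ℝ) : EReal) * G k z y θ) x p)
    (hP : ∀ k, LocallyLipschitzOn (Set.univ ×ˢ Ω) (GFB.atObs (GFB.proxG ν G k) y))
    (ha₀ : LocallyLipschitzOn Ω (a₀ y)) :
    (∀ ℓ : ℕ,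
      (∃ J, GFB.IsWeakJacobian Ω (fun θ => GFB.iter F G ν a₀ ℓ y θ) J) ∧
      (∃ J, GFB.IsWeakJacobian Ω (fun θ => GFB.gam (GFB.iter F G ν a₀ ℓ y θ)) J) ∧
      (∀ k, ∃ J, GFB.IsWeakJacobian Ω (fun θ => (GFB.iter F G ν a₀ ℓ y θ).2 k) J) ∧
      (∀ k, ∃ J, GFB.IsWeakJacobian Ω
        (fun θ => GFB.zarg F ν k (GFB.iter F G ν a₀ ℓ y θ) y θ) J)) ∧
    (∀ (Ja : ℕ → T → T →L[ℝ] X × (Fin Q → X)) (Jx : ℕ → T → T →L[ℝ] X)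
      (Jz JZ : ℕ → Fin Q → T → T →L[ℝ] X),
      (∀ ℓ, GFB.IsWeakJacobian Ω (fun θ => GFB.iter F G ν a₀ ℓ y θ) (Ja ℓ)) →
      (∀ ℓ, GFB.IsWeakJacobian Ω (fun θ => GFB.gam (GFB.iter F G ν a₀ ℓ y θ)) (Jx ℓ)) →
      (∀ ℓ k, GFB.IsWeakJacobian Ω (fun θ => (GFB.iter F G ν a₀ ℓ y θ).2 k) (Jz ℓ k)) →
      (∀ ℓ k, GFB.IsWeakJacobian Ω
        (fun θ => GFB.zarg F ν k (GFB.iter F G ν a₀ ℓ y θ) y θ) (JZ ℓ k)) →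
      ∀ ℓ : ℕ, ∀ᵐ θ ∂(volume.restrict Ω),
        ∀ (a : X × (Fin Q → X)) (x : X) (Z : Fin Q → X),
        a = GFB.iter F G ν a₀ ℓ y θ → x = GFB.gam a → (∀ k, Z k = GFB.zarg F ν k a y θ) →
        (∀ δ, Ja ℓ θ δ = (Jx ℓ θ δ, fun k => Jz ℓ k θ δ)) ∧
        Jx ℓ θ = (fderiv ℝ (GFB.gam (X := X) (Q := Q)) a) ∘L (Ja ℓ θ) ∧
        (∀ δ, LineDifferentiableAt ℝ (GFB.atObs (GFB.psi F G ν) y) (a, θ) (Ja ℓ θ δ, δ) ∧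
          Ja (ℓ + 1) θ δ =
            lineDeriv ℝ (GFB.atObs (GFB.psi F G ν) y) (a, θ) (Ja ℓ θ δ, δ)) ∧
        (DifferentiableAt ℝ (GFB.atObs (GFB.psi F G ν) y) (a, θ) →
          Ja (ℓ + 1) θ = (GFB.jac1 (GFB.psi F G ν) a y θ) ∘L (Ja ℓ θ)
            + GFB.jac3 (GFB.psi F G ν) a y θ) ∧
        Jx (ℓ + 1) θ = (1 / (Q : ℝ)) • ∑ k, Jz (ℓ + 1) k θ ∧
        ∀ k,
          (∀ δ, LineDifferentiableAt ℝ (GFB.atObs (GFB.proxG ν G k) y) (Z k, θ)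
              (JZ ℓ k θ δ, δ) ∧
            Jz (ℓ + 1) k θ δ = Jz ℓ k θ δ - Jx ℓ θ δ +
              lineDeriv ℝ (GFB.atObs (GFB.proxG ν G k) y) (Z k, θ) (JZ ℓ k θ δ, δ)) ∧
          (DifferentiableAt ℝ (GFB.atObs (GFB.proxG ν G k) y) (Z k, θ) →
            Jz (ℓ + 1) k θ = Jz ℓ k θ - Jx ℓ θ
              + (GFB.jac1 (GFB.proxG ν G k) (Z k) y θ) ∘L (JZ ℓ k θ)
              + GFB.jac3 (GFB.proxG ν G k) (Z k) y θ) ∧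
          (∀ δ, LineDifferentiableAt ℝ (GFB.atObs (GFB.grad1 F) y) (x, θ) (Jx ℓ θ δ, δ) ∧
            JZ ℓ k θ δ = (2 : ℝ) • Jx ℓ θ δ - Jz ℓ k θ δ -
              ν • lineDeriv ℝ (GFB.atObs (GFB.grad1 F) y) (x, θ) (Jx ℓ θ δ, δ)) ∧
          (DifferentiableAt ℝ (GFB.atObs (GFB.grad1 F) y) (x, θ) →
            JZ ℓ k θ = (2 : ℝ) • Jx ℓ θ - Jz ℓ k θ
              - ν • ((GFB.jac1 (GFB.grad1 F) x y θ) ∘L (Jx ℓ θ)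
                + GFB.jac3 (GFB.grad1 F) x y θ))) := by
  have hψ : LocallyLipschitzOn (Set.univ ×ˢ Ω) (GFB.atObs (GFB.psi F G ν) y) :=
    GFB.locallyLipschitzOn_psi hFlip hP
      LipschitzWith.prod_fst.locallyLipschitz.locallyLipschitzOn
      LipschitzWith.prod_snd.locallyLipschitz.locallyLipschitzOn fun _ hp => hp.2
  have ha := GFB.locallyLipschitzOn_iter hFlip hP ha₀
  have hx := fun ℓ => GFB.locallyLipschitzOn_locallyLipschitz_comp
    LipschitzWith.prod_fst.locallyLipschitz (ha ℓ)
  have hz := fun ℓ k => GFB.locallyLipschitzOn_locallyLipschitz_comp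
    ((LipschitzWith.eval k).comp LipschitzWith.prod_snd).locallyLipschitz (ha ℓ)
  have hZ := fun ℓ k => GFB.locallyLipschitzOn_zarg (ν := ν) hFlip (ha ℓ)
    LocallyLipschitz.id.locallyLipschitzOn (Set.mapsTo_id Ω) k
  refine ⟨fun ℓ => ⟨⟨_, GFB.isWeakJacobian_fderiv hΩ (ha ℓ)⟩,
    ⟨_, GFB.isWeakJacobian_fderiv hΩ (hx ℓ)⟩, fun k => ⟨_, GFB.isWeakJacobian_fderiv hΩ (hz ℓ k)⟩,
    fun k => ⟨_, GFB.isWeakJacobian_fderiv hΩ (hZ ℓ k)⟩⟩, fun Ja Jx Jz JZ hJa hJx hJz hJZ ℓ => ?_⟩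
  have hdz := fun ℓ => ae_all_iff.2 fun k => (hJz ℓ k).ae_hasFDerivAt hΩ (hz ℓ k)
  have hdZ := ae_all_iff.2 fun k => (hJZ ℓ k).ae_hasFDerivAt hΩ (hZ ℓ k)
  filter_upwards [ae_restrict_mem hΩ.measurableSet, (hJa ℓ).ae_hasFDerivAt hΩ (ha ℓ),
    (hJa (ℓ + 1)).ae_hasFDerivAt hΩ (ha (ℓ + 1)), (hJx ℓ).ae_hasFDerivAt hΩ (hx ℓ),
    (hJx (ℓ + 1)).ae_hasFDerivAt hΩ (hx (ℓ + 1)), hdz ℓ, hdz (ℓ + 1), hdZ]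
    with θ hθ da da' dx dx' dz dz' dZ
  rintro a x Z rfl rfl hZeq
  obtain rfl := funext hZeq
  have hΩθ := hΩ.mem_nhds hθ
  have hline := GFB.hasLineDerivAt_atObs hψ hΩθ da da'
  exact ⟨DFunLike.congr_fun (da.unique (dx.prodMk (hasFDerivAt_pi.2 dz))),
    dx.unique (differentiableAt_fst.hasFDerivAt.comp θ da),
    fun δ => ⟨(hline δ).lineDifferentiableAt, (hline δ).lineDeriv.symm⟩,
    fun hd => GFB.eq_jac1_comp_add_jac3 hd da da',
    dx'.unique ((HasFDerivAt.fun_sum fun k _ => dz' k).fun_const_smul (1 / (Q : ℝ))),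
    fun k => ⟨GFB.znext_fderiv_apply_eq_lineDeriv (hP k) hΩθ dx (dz k) (dz' k) (dZ k),
      fun hd => GFB.znext_fderiv_eq_jac hd dx (dz k) (dz' k) (dZ k),
      GFB.zarg_fderiv_apply_eq_lineDeriv hν hFlip hΩθ dx (dz k) (dZ k),
      fun hd => GFB.zarg_fderiv_eq_jac hν hd dx (dz k) (dZ k)⟩⟩

theorem mainTheorem9
    {X : Type*} [NormedAddCommGroup X] [InnerProductSpace ℝ X] [FiniteDimensional ℝ X]
    [CompleteSpace X]
    {Y : Type*} [NormedAddCommGroup Y] [InnerProductSpace ℝ Y] [FiniteDimensional ℝ Y]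
    {T : Type*} [NormedAddCommGroup T] [InnerProductSpace ℝ T] [FiniteDimensional ℝ T]
    [MeasurableSpace T] [BorelSpace T]
    (Ω : Set T) (hΩ : IsOpen Ω) (y : Y)
    (Q : ℕ) (hQ : 0 < Q) (ν : ℝ) (hν : 0 < ν)
    (F : X → Y → T → ℝ) (G : Fin Q → X → Y → T → EReal)
    (a₀ : Y → T → X × (Fin Q → X))
    (hF : ∀ θ ∈ Ω, ContDiff ℝ 1 (fun x => F x y θ))
    (hFlip : LocallyLipschitzOn (Set.univ ×ˢ Ω) (GFB.atObs (GFB.grad1 F) y))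
    (hG : ∀ k, ∀ θ ∈ Ω, GFB.IsProperClosedConvex (fun x => G k x y θ))
    (hGlip : ∀ k, GFB.LocallyLipschitzInParam Ω (fun x θ => GFB.proxG ν G k x y θ))
    (ha₀ : LocallyLipschitzOn Ω (a₀ y)) :
    -- the iterates and the points `Z_k` are weakly differentiable in `θ`
    (∀ ℓ : ℕ,
      (∃ J, GFB.IsWeakJacobian Ω (fun θ => GFB.iter F G ν a₀ ℓ y θ) J) ∧
      (∃ J, GFB.IsWeakJacobian Ω (fun θ => GFB.gam (GFB.iter F G ν a₀ ℓ y θ)) J) ∧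
      (∀ k, ∃ J, GFB.IsWeakJacobian Ω (fun θ => (GFB.iter F G ν a₀ ℓ y θ).2 k) J) ∧
      (∀ k, ∃ J, GFB.IsWeakJacobian Ω
        (fun θ => GFB.zarg F ν k (GFB.iter F G ν a₀ ℓ y θ) y θ) J)) ∧
    -- and all their weak Jacobians obey the recursion
    (∀ (Ja : ℕ → T → T →L[ℝ] X × (Fin Q → X)) (Jx : ℕ → T → T →L[ℝ] X)
      (Jz JZ : ℕ → Fin Q → T → T →L[ℝ] X),
      (∀ ℓ, GFB.IsWeakJacobian Ω (fun θ => GFB.iter F G ν a₀ ℓ y θ) (Ja ℓ)) →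
      (∀ ℓ, GFB.IsWeakJacobian Ω (fun θ => GFB.gam (GFB.iter F G ν a₀ ℓ y θ)) (Jx ℓ)) →
      (∀ ℓ k, GFB.IsWeakJacobian Ω (fun θ => (GFB.iter F G ν a₀ ℓ y θ).2 k) (Jz ℓ k)) →
      (∀ ℓ k, GFB.IsWeakJacobian Ω
        (fun θ => GFB.zarg F ν k (GFB.iter F G ν a₀ ℓ y θ) y θ) (JZ ℓ k)) →
      ∀ ℓ : ℕ, ∀ᵐ θ ∂(volume.restrict Ω),
        ∀ (a : X × (Fin Q → X)) (x : X) (Z : Fin Q → X),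
        a = GFB.iter F G ν a₀ ℓ y θ → x = GFB.gam a → (∀ k, Z k = GFB.zarg F ν k a y θ) →
        -- `J_a = (J_x, J_{z_1}, …, J_{z_Q})` and `J_x = Γ_a (J_a)`
        (∀ δ, Ja ℓ θ δ = (Jx ℓ θ δ, fun k => Jz ℓ k θ δ)) ∧
        Jx ℓ θ = (fderiv ℝ (GFB.gam (X := X) (Q := Q)) a) ∘L (Ja ℓ θ) ∧
        -- `J_a⁺ = Ψ_a (J_a) + Ψ_θ`
        (∀ δ, LineDifferentiableAt ℝ (GFB.atObs (GFB.psi F G ν) y) (a, θ) (Ja ℓ θ δ, δ) ∧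
          Ja (ℓ + 1) θ δ =
            lineDeriv ℝ (GFB.atObs (GFB.psi F G ν) y) (a, θ) (Ja ℓ θ δ, δ)) ∧
        (DifferentiableAt ℝ (GFB.atObs (GFB.psi F G ν) y) (a, θ) →
          Ja (ℓ + 1) θ = (GFB.jac1 (GFB.psi F G ν) a y θ) ∘L (Ja ℓ θ)
            + GFB.jac3 (GFB.psi F G ν) a y θ) ∧
        -- `J_x⁺ = (1/Q) ∑ J_{z_k}⁺`
        Jx (ℓ + 1) θ = (1 / (Q : ℝ)) • ∑ k, Jz (ℓ + 1) k θ ∧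
        ∀ k,
          -- `J_{z_k}⁺ = J_{z_k} - J_x + G_{k,x} (J_{Z_k}) + G_{k,θ}`
          (∀ δ, LineDifferentiableAt ℝ (GFB.atObs (GFB.proxG ν G k) y) (Z k, θ)
              (JZ ℓ k θ δ, δ) ∧
            Jz (ℓ + 1) k θ δ = Jz ℓ k θ δ - Jx ℓ θ δ +
              lineDeriv ℝ (GFB.atObs (GFB.proxG ν G k) y) (Z k, θ) (JZ ℓ k θ δ, δ)) ∧
          (DifferentiableAt ℝ (GFB.atObs (GFB.proxG ν G k) y) (Z k, θ) →
            Jz (ℓ + 1) k θ = Jz ℓ k θ - Jx ℓ θ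
              + (GFB.jac1 (GFB.proxG ν G k) (Z k) y θ) ∘L (JZ ℓ k θ)
              + GFB.jac3 (GFB.proxG ν G k) (Z k) y θ) ∧
          -- `J_{Z_k} = 2 J_x - J_{z_k} - ν (F_x (J_x) + F_θ)`
          (∀ δ, LineDifferentiableAt ℝ (GFB.atObs (GFB.grad1 F) y) (x, θ) (Jx ℓ θ δ, δ) ∧
            JZ ℓ k θ δ = (2 : ℝ) • Jx ℓ θ δ - Jz ℓ k θ δ -
              ν • lineDeriv ℝ (GFB.atObs (GFB.grad1 F) y) (x, θ) (Jx ℓ θ δ, δ)) ∧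
          (DifferentiableAt ℝ (GFB.atObs (GFB.grad1 F) y) (x, θ) →
            JZ ℓ k θ = (2 : ℝ) • Jx ℓ θ - Jz ℓ k θ
              - ν • ((GFB.jac1 (GFB.grad1 F) x y θ) ∘L (Jx ℓ θ)
                + GFB.jac3 (GFB.grad1 F) x y θ))) := by
  exact mainTheorem9_general Ω hΩ y Q hQ ν hν.ne' F G a₀ hF hFlip
    (fun k θ hθ => ((hG k θ hθ).const_mul (by positivity)).existsUnique_isProxPoint)
    (fun k => GFB.locallyLipschitzOn_proxG hQ hν (hG k) (hGlip k)) ha₀
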